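/- Let $n\ge 1$, $N\ge n$, and let $M\subset\mathbb C^N$ be a compact, smoothly embedded real submanifold of dimension $2n-1$. Let $T^{1,0}_p(M)=T^{1,0}_p(\mathbb C^N)\cap(T_p(M)\otimes\mathbb C)$ and $T^{0,1}_p(M)=\overline{T^{1,0}_p(M)}$, and assume that $\dim_{\mathbb C}T^{1,0}_p(M)=n-1$ for all $p\in M$, so that $M$ is a CR-manifold of hypersurface type with the induced CR-structure. For a purely imaginary $1$-form $\gamma$ on $M$ annihilating $T^{1,0}(M)\oplus T^{0,1}(M)$, the Levi form is $\langle d\gamma,L\wedge\bar L'\rangle$, where $\langle\eta,Z\wedge W\rangle=\eta(Z,W)$ and $d\gamma(X,Y)=X\gamma(Y)-Y\gamma(X)-\gamma([X,Y])$. Assume that $M$ is weakly pseudoconvex: for some global nowhere vanishing smooth such $\gamma$ the Levi form is positive semi-definite at every point. Equip $T(\mathbb C^N)\otimes\mathbb C$ with the Hermitian inner product in which the vectors $\partial/\partial z_j,\ \partial/\partial\bar z_j$ are orthonormal. For a function $\lambda$ smooth near $M$, let $\partial_b\lambda$ (resp. $\bar\partial_b\lambda$) be the $1$-form on $M$ that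 equals $d\lambda$ on $T^{1,0}(M)$ (resp. $T^{0,1}(M)$) and vanishes on the orthogonal complement of that bundle in $T(M)\otimes\mathbb C$; let $\partial_b\bar\partial_b\lambda$ and $\bar\partial_b\partial_b\lambda$ be the $(1,1)$-parts, with respect to $T^{1,0}(M)\oplus T^{0,1}(M)$, of the exterior derivatives on $M$ of $\bar\partial_b\lambda$ and $\partial_b\lambda$. Let $U\subset M$ be open (for instance $U=M$), and let $L_n$ be a smooth field on $U$ of unit vectors in $T^{1,0}(\mathbb C^N)$, orthogonal to $T^{1,0}(M)$, such that $T=L_n-\bar L_n$ is tangent to $M$ (that is, $T\in T(M)\otimes\mathbb C$). Let $\nu=L_n+\bar L_n$ be the corresponding "real normal", and let $\gamma$ be the smooth purely imaginary $1$-form on $U$ that annihilates $T^{1,0}(M)\oplus T^{0,1}(M)$ and satisfies $\langle\gamma,T\rangle=-1$. **Proposition.** If $\lambda$ is a smooth complex-valued function on a neighborhood of $M$ in $\mathbb C^N$, then for every $p\in U$ and every $L\in T^{1,0}_p(M)$, at the point $p$, $$\Big\langle\tfrac12\big(\partial\bar\partial\lambda-\bar\partial\partial\lambda\big),L\wedge\bar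 L\Big\rangle-\Big\langle\tfrac12\big(\partial_b\bar\partial_b\lambda-\bar\partial_b\partial_b\lambda\big),L\wedge\bar L\Big\rangle=\tfrac12\,\nu\{\lambda\}\,\langle d\gamma,L\wedge\bar L\rangle .$$ -/

import Mathlib

open scoped ContDiff Manifold

noncomputable section

/-! ### The complexified tangent space of `ℂ^N` -/

/-- `ℂ^N` with its Euclidean norm; it also serves as the real tangent space of `ℂ^N` at each point. -/
abbrev CSpace (N : ℕ) : Type := EuclideanSpace ℂ (Fin N)

/-- The complexified tangent space `T(ℂ^N) ⊗ ℂ` at a point, written in the basis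
`∂/∂z_j` (index `Sum.inl j`), `∂/∂z̄_j` (index `Sum.inr j`), with the Hermitian inner product in
which this basis is orthonormal. -/
abbrev CTan (N : ℕ) : Type := EuclideanSpace ℂ (Fin N ⊕ Fin N)

variable {N : ℕ}

/-- The complexified tangent vector of a real tangent vector `v`:
`∑ v_j ∂/∂z_j + ∑ conj v_j ∂/∂z̄_j`. -/
def CTan.ofReal : CSpace N →L[ℝ] CTan N :=
  LinearMap.toContinuousLinearMap
    { toFun := fun v => WithLp.toLp 2 (Sum.elim (fun j => v j) (fun j => starRingEnd ℂ (v j)))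
      map_add' := by
        intro v w
        ext (j | j) <;> simp
      map_smul' := by
        intro c v
        ext (j | j) <;> simp }

/-- The real tangent vector `X` in the decomposition `Z = X + i Y`. -/
def CTan.re : CTan N →L[ℝ] CSpace N :=
  LinearMap.toContinuousLinearMap
    { toFun := fun Z => WithLp.toLp 2
        (fun j => (Z (Sum.inl j) + starRingEnd ℂ (Z (Sum.inr j))) / 2)
      map_add' := by
        intro v w
        ext j
        simp
        ring
      map_smul' := by
        intro c v
        ext j
        simp
        ring }

/-- The real tangent vector `Y` in the decomposition `Z = X + i Y`. -/
def CTan.im : CTan N →L[ℝ] CSpace N :=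
  LinearMap.toContinuousLinearMap
    { toFun := fun Z => WithLp.toLp 2
        (fun j => (Z (Sum.inl j) - starRingEnd ℂ (Z (Sum.inr j))) / (2 * Complex.I))
      map_add' := by
        intro v w
        ext j
        simp
        ring
      map_smul' := by
        intro c v
        ext j
        simp
        ring }

theorem CTan.re_add_im (Z : CTan N) :
    CTan.ofReal (CTan.re Z) + Complex.I • CTan.ofReal (CTan.im Z) = Z := by
  have hI : Complex.I ≠ 0 := Complex.I_ne_zero
  ext (j | j)
  · simp [CTan.ofReal, CTan.re, CTan.im]
    field_simp
    ring
  · simp [CTan.ofReal, CTan.re, CTan.im]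
    field_simp
    simp only [Complex.conj_ofNat]
    ring

/-- Complex conjugation `X + i Y ↦ X - i Y` of complexified tangent vectors; it exchanges
`∂/∂z_j` and `∂/∂z̄_j`. -/
def CTan.conj : CTan N →ₛₗ[starRingEnd ℂ] CTan N where
  toFun Z := WithLp.toLp 2 (Sum.elim (fun j => starRingEnd ℂ (Z (Sum.inr j)))
    (fun j => starRingEnd ℂ (Z (Sum.inl j))))
  map_add' := by
    intro v w
    ext (j | j) <;> simp
  map_smul' := by
    intro c v
    ext (j | j) <;> simp

/-- `T^{1,0}(ℂ^N)` at a point: the span of the `∂/∂z_j`. -/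
def CTan.T10 (N : ℕ) : Submodule ℂ (CTan N) where
  carrier := {Z | ∀ j, Z (Sum.inr j) = 0}
  zero_mem' := by
    intro j
    simp
  add_mem' := by
    intro v w hv hw j
    simp [hv j, hw j]
  smul_mem' := by
    intro c v hv j
    simp [hv j]

/-- `T^{0,1}(ℂ^N)` at a point, the conjugate of `T^{1,0}(ℂ^N)`. -/
def CTan.T01 (N : ℕ) : Submodule ℂ (CTan N) := (CTan.T10 N).map CTan.conj

/-! ### Pairing complex-valued forms with complexified tangent vectors -/

/-- The pairing `⟨α, X + i Y⟩ = α(X) + i α(Y)` of a complex-valued 1-form. -/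
def pair1 (α : CSpace N →L[ℝ] ℂ) : CTan N →L[ℝ] ℂ :=
  α.comp CTan.re + Complex.I • α.comp CTan.im

/-- The pairing `⟨η, Z ∧ W⟩` of a complex-valued 2-form: the complex bilinear extension of `η`. -/
def pair2 (η : CSpace N [⋀^Fin 2]→L[ℝ] ℂ) (Z W : CTan N) : ℂ :=
  η ![CTan.re Z, CTan.re W] - η ![CTan.im Z, CTan.im W]
    + Complex.I * (η ![CTan.re Z, CTan.im W] + η ![CTan.im Z, CTan.re W])

/-- The component of a complex-valued 1-form along a complex subspace `S` of complexified tangent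
vectors: the 1-form `α ∘ (orthogonal projection onto S)`. -/
def component1 (S : Submodule ℂ (CTan N)) (α : CSpace N →L[ℝ] ℂ) : CSpace N →L[ℝ] ℂ :=
  (pair1 α).comp ((S.starProjection.restrictScalars ℝ).comp CTan.ofReal)

/-- The `(1,1)`-component of a complex-valued 2-form with respect to orthogonal subspaces `S` and
`S'` of vectors of type `(1,0)` and `(0,1)`, as a bilinear form on complexified vectors. -/
def component11 (S S' : Submodule ℂ (CTan N)) (η : CSpace N [⋀^Fin 2]→L[ℝ] ℂ)
    (Z W : CTan N) : ℂ :=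
  pair2 η (S.starProjection Z) (S'.starProjection W)
    + pair2 η (S'.starProjection Z) (S.starProjection W)

/-- The exterior derivative of a complex-valued 1-form on a real normed space, normalised so that
`dα(X, Y) = (D_X α)(Y) - (D_Y α)(X)`. -/
def extDeriv1 {V : Type*} [NormedAddCommGroup V] [NormedSpace ℝ V] (α : V → V →L[ℝ] ℂ) (x : V) :
    V [⋀^Fin 2]→L[ℝ] ℂ :=
  extDeriv (fun y => ContinuousAlternatingMap.ofSubsingleton ℝ V ℂ (0 : Fin 1) (α y)) x

/-! ### The operators `∂` and `∂̄` on `ℂ^N` -/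

/-- `∂λ`, the `(1,0)`-part of `dλ`. -/
def del (lam : CSpace N → ℂ) (x : CSpace N) : CSpace N →L[ℝ] ℂ :=
  component1 (CTan.T10 N) (fderiv ℝ lam x)

/-- `∂̄λ`, the `(0,1)`-part of `dλ`. -/
def dbar (lam : CSpace N → ℂ) (x : CSpace N) : CSpace N →L[ℝ] ℂ :=
  component1 (CTan.T01 N) (fderiv ℝ lam x)

/-- `∂α` for a form `α` of type `(0,1)`: the `(1,1)`-part of `dα`. -/
def del01 (α : CSpace N → CSpace N →L[ℝ] ℂ) (x : CSpace N) (Z W : CTan N) : ℂ :=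
  component11 (CTan.T10 N) (CTan.T01 N) (extDeriv1 α x) Z W

/-- `∂̄β` for a form `β` of type `(1,0)`: the `(1,1)`-part of `dβ`. -/
def dbar10 (β : CSpace N → CSpace N →L[ℝ] ℂ) (x : CSpace N) (Z W : CTan N) : ℂ :=
  component11 (CTan.T10 N) (CTan.T01 N) (extDeriv1 β x) Z W

/-! ### Embedded manifolds, the induced CR structure and forms on them

A 1-form on a manifold `M` mapped to `ℂ^N` by `ι` is written as a function
`α : M → (CSpace N →L[ℝ] ℂ)`; only the values of `α p` on vectors tangent to `M` at `p` matter. -/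

variable (m : ℕ) {M : Type*} [TopologicalSpace M] [ChartedSpace (EuclideanSpace ℝ (Fin m)) M]

/-- The differential of `ι` at `p`, as a map from the model space. -/
def embDeriv (ι : M → CSpace N) (p : M) : EuclideanSpace ℝ (Fin m) →L[ℝ] CSpace N :=
  mfderiv (𝓡 m) 𝓘(ℝ, CSpace N) ι p

/-- The real tangent space `T_p(M)` as a subspace of `ℂ^N`. -/
def tangentSub (ι : M → CSpace N) (p : M) : Submodule ℝ (CSpace N) :=
  LinearMap.range (embDeriv m ι p).toLinearMap

/-- The complexified tangent space `T_p(M) ⊗ ℂ`. -/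
def complexTangent (ι : M → CSpace N) (p : M) : Submodule ℂ (CTan N) :=
  Submodule.span ℂ (CTan.ofReal '' (tangentSub m ι p : Set (CSpace N)))

/-- `T^{1,0}_p(M) = T^{1,0}(ℂ^N) ∩ (T_p(M) ⊗ ℂ)`. -/
def T10M (ι : M → CSpace N) (p : M) : Submodule ℂ (CTan N) :=
  CTan.T10 N ⊓ complexTangent m ι p

/-- `T^{0,1}_p(M)`, the conjugate of `T^{1,0}_p(M)`. -/
def T01M (ι : M → CSpace N) (p : M) : Submodule ℂ (CTan N) :=
  (T10M m ι p).map CTan.conj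

/-- The pull-back of a 1-form on `M` to the coordinates of the preferred chart at `p`. -/
def chartForm (ι : M → CSpace N) (α : M → CSpace N →L[ℝ] ℂ) (p : M)
    (u : EuclideanSpace ℝ (Fin m)) : EuclideanSpace ℝ (Fin m) →L[ℝ] ℂ :=
  (α ((extChartAt (𝓡 m) p).symm u)).comp (fderiv ℝ (ι ∘ (extChartAt (𝓡 m) p).symm) u)

/-- The exterior derivative on `M` of a 1-form on `M` at `p`, computed in the preferred chart at
`p`. Tangent vectors in `T_p(M)` are moved to the coordinates by the inverse of the (injective)
differential of `ι`; only the values on `T_p(M)` matter. -/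
def extDerivM (ι : M → CSpace N) (α : M → CSpace N →L[ℝ] ℂ) (p : M) :
    CSpace N [⋀^Fin 2]→L[ℝ] ℂ :=
  (extDeriv1 (chartForm m ι α p) (extChartAt (𝓡 m) p p)).compContinuousLinearMap
    (LinearMap.toContinuousLinearMap (embDeriv m ι p).toLinearMap.leftInverse)

/-- The CR structure induced on `M` has constant complex rank `n - 1`. -/
def IsCROfRank (ι : M → CSpace N) (n : ℕ) : Prop :=
  ∀ p, Module.finrank ℂ (T10M m ι p) = n - 1

/-- `γ` restricts on the open set `U` of `M` to a smooth, purely imaginary, nowhere vanishing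
1-form that annihilates `T^{1,0}(M) ⊕ T^{0,1}(M)`. -/
structure IsCharacteristicForm (ι : M → CSpace N) (U : Set M) (γ : M → CSpace N →L[ℝ] ℂ) :
    Prop where
  smooth : ContMDiffOn (𝓡 m) 𝓘(ℝ, CSpace N →L[ℝ] ℂ) ∞ γ U
  imaginary : ∀ p ∈ U, ∀ v ∈ tangentSub m ι p, (γ p v).re = 0
  annihilates : ∀ p ∈ U, ∀ Z ∈ T10M m ι p ⊔ T01M m ι p, pair1 (γ p) Z = 0
  nonvanishing : ∀ p ∈ U, ∃ v ∈ tangentSub m ι p, γ p v ≠ 0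

/-- The Levi form `⟨dγ_p, L ∧ conj L'⟩`. -/
def leviForm (ι : M → CSpace N) (γ : M → CSpace N →L[ℝ] ℂ) (p : M) (L L' : CTan N) : ℂ :=
  pair2 (extDerivM m ι γ p) L (CTan.conj L')

/-- `M` is weakly pseudoconvex: for some global characteristic form the Levi form is positive
semi-definite at every point. -/
def IsWeaklyPseudoconvex (ι : M → CSpace N) : Prop :=
  ∃ γ : M → CSpace N →L[ℝ] ℂ, IsCharacteristicForm m ι Set.univ γ ∧
    ∀ p, ∀ L ∈ T10M m ι p, 0 ≤ (leviForm m ι γ p L L).re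

/-- The last field `L_n` of a local orthonormal frame on the open set `U` of `M`: a smooth unit
field of type `(1,0)` in `ℂ^N`, orthogonal to `T^{1,0}(M)`, for which
`T = L_n - conj L_n` is tangent to `M`. -/
structure IsTransversalField (ι : M → CSpace N) (U : Set M) (Ln : M → CTan N) : Prop where
  smooth : ContMDiffOn (𝓡 m) 𝓘(ℝ, CTan N) ∞ Ln U
  type10 : ∀ p ∈ U, Ln p ∈ CTan.T10 N
  unit : ∀ p ∈ U, ‖Ln p‖ = 1
  orthogonal : ∀ p ∈ U, ∀ Z ∈ T10M m ι p, inner ℂ Z (Ln p) = 0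
  tangent : ∀ p ∈ U, Ln p - CTan.conj (Ln p) ∈ complexTangent m ι p

/-! ### The tangential operators `∂_b` and `∂̄_b` -/

/-- `∂_b λ`: the restriction of `dλ` to `T^{1,0}(M)`, extended by zero to the orthogonal
complement of `T^{1,0}(M)`. -/
def delb (ι : M → CSpace N) (lam : CSpace N → ℂ) (p : M) : CSpace N →L[ℝ] ℂ :=
  component1 (T10M m ι p) (fderiv ℝ lam (ι p))

/-- `∂̄_b λ`: the restriction of `dλ` to `T^{0,1}(M)`, extended by zero to the orthogonal
complement of `T^{0,1}(M)`. -/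
def dbarb (ι : M → CSpace N) (lam : CSpace N → ℂ) (p : M) : CSpace N →L[ℝ] ℂ :=
  component1 (T01M m ι p) (fderiv ℝ lam (ι p))

/-- `∂_b α` for a form `α` of type `(0,1)` on `M`: the `(1,1)`-part of the exterior derivative of
`α` on `M`. -/
def delb01 (ι : M → CSpace N) (α : M → CSpace N →L[ℝ] ℂ) (p : M) (Z W : CTan N) : ℂ :=
  component11 (T10M m ι p) (T01M m ι p) (extDerivM m ι α p) Z W

/-- `∂̄_b β` for a form `β` of type `(1,0)` on `M`: the `(1,1)`-part of the exterior derivative of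
`β` on `M`. -/
def dbarb10 (ι : M → CSpace N) (β : M → CSpace N →L[ℝ] ℂ) (p : M) (Z W : CTan N) : ℂ :=
  component11 (T10M m ι p) (T01M m ι p) (extDerivM m ι β p) Z W

end

/-! Put T = L_n - conj L_n. The spaces T^{1,0}(M), T^{0,1}(M) and ℂT are mutually orthogonal in T(M)
⊗ ℂ, and counting dimensions shows that they fill it. For Z = X + Y + cT in this splitting, γ(Z) =
-c, while the (1,0)-part of Z in ℂ^N is X + c L_n. Thus the two notions of type differ by γ(Z) times
L_n or conj L_n (`IsTransversalField.starProjection_eq`). As forms on M this says ∂_b λ = ∂λ + (L_n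
λ) γ and ∂̄_b λ = ∂̄λ - (conj L_n λ) γ (`IsTransversalField.delb_dbarb_eq`).

Now apply d on M. It commutes with restriction from ℂ^N, and d(gγ) = dg ∧ γ + g dγ, whose first term
vanishes on L ∧ conj L because γ kills both vectors (`extDerivM_eq_of_forall_eq`). Subtracting the
two identities leaves the coefficient L_n λ + conj L_n λ = ν λ in front of dγ.

Smooth dependence of T^{1,0}_p(M) on p is never needed: the right-hand sides of the two formulas are
visibly differentiable in a chart. -/

open scoped Topology

/-! ### Real and imaginary parts, conjugation and types of complexified vectors -/

namespace CTan
variable {N : ℕ}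

theorem ofReal_inl (v : CSpace N) (j : Fin N) : ofReal v (Sum.inl j) = v j := rfl

theorem ofReal_inr (v : CSpace N) (j : Fin N) :
    ofReal v (Sum.inr j) = starRingEnd ℂ (v j) := rfl

theorem conj_inl (Z : CTan N) (j : Fin N) :
    conj Z (Sum.inl j) = starRingEnd ℂ (Z (Sum.inr j)) := rfl

theorem conj_inr (Z : CTan N) (j : Fin N) :
    conj Z (Sum.inr j) = starRingEnd ℂ (Z (Sum.inl j)) := rfl

theorem re_apply (Z : CTan N) (j : Fin N) :
    re Z j = (Z (Sum.inl j) + starRingEnd ℂ (Z (Sum.inr j))) / 2 := rfl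

theorem im_apply (Z : CTan N) (j : Fin N) :
    im Z j = (Z (Sum.inl j) - starRingEnd ℂ (Z (Sum.inr j))) / (2 * Complex.I) := rfl

theorem mem_T10 {Z : CTan N} : Z ∈ T10 N ↔ ∀ j, Z (Sum.inr j) = 0 := Iff.rfl

@[simp]
theorem conj_conj (Z : CTan N) : conj (conj Z) = Z := by
  ext (j | j) <;> simp [conj_inl, conj_inr]

@[simp]
theorem conj_ofReal (v : CSpace N) : conj (ofReal v) = ofReal v := by
  ext (j | j) <;> simp [conj_inl, conj_inr, ofReal_inl, ofReal_inr]

@[simp]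
theorem re_ofReal (v : CSpace N) : re (ofReal v) = v := by
  ext j
  simp [re_apply, ofReal_inl, ofReal_inr]

@[simp]
theorem im_ofReal (v : CSpace N) : im (ofReal v) = 0 := by
  ext j
  simp [im_apply, ofReal_inl, ofReal_inr]

theorem re_smul (c : ℂ) (Z : CTan N) : re (c • Z) = c.re • re Z - c.im • im Z := by
  have hI : Complex.I ≠ 0 := Complex.I_ne_zero
  have hc := Complex.re_add_im c
  have hc' : starRingEnd ℂ c = c.re - c.im * Complex.I := by
    apply Complex.ext <;> simp
  ext j
  simp only [re_apply, im_apply, PiLp.smul_apply, PiLp.sub_apply, smul_eq_mul, Complex.real_smul,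
    map_mul, hc']
  generalize (c.re : ℂ) = a at *
  generalize (c.im : ℂ) = b at *
  subst hc
  field_simp
  linear_combination (b * (Z (Sum.inl j) - starRingEnd ℂ (Z (Sum.inr j)))) * Complex.I_sq

theorem im_smul (c : ℂ) (Z : CTan N) : im (c • Z) = c.re • im Z + c.im • re Z := by
  have hI : Complex.I ≠ 0 := Complex.I_ne_zero
  have hc := Complex.re_add_im c
  have hc' : starRingEnd ℂ c = c.re - c.im * Complex.I := by
    apply Complex.ext <;> simp
  ext j
  simp only [re_apply, im_apply, PiLp.smul_apply, PiLp.add_apply, smul_eq_mul, Complex.real_smul,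
    map_mul, hc']
  generalize (c.re : ℂ) = a at *
  generalize (c.im : ℂ) = b at *
  subst hc
  field_simp
  ring

@[simp]
theorem re_conj (Z : CTan N) : re (conj Z) = re Z := by
  ext j
  simp [re_apply, conj_inl, conj_inr, add_comm]

@[simp]
theorem im_conj (Z : CTan N) : im (conj Z) = -im Z := by
  ext j
  simp only [im_apply, conj_inl, conj_inr, Complex.conj_conj, PiLp.neg_apply]
  ring

theorem inner_conj_conj (Z W : CTan N) :
    inner ℂ (conj Z) (conj W) = starRingEnd ℂ (inner ℂ Z W) := by
  simp only [PiLp.inner_apply, Fintype.sum_sum_type, conj_inl, conj_inr, map_add, map_sum,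
    RCLike.inner_apply, map_mul]
  rw [add_comm]

theorem inner_eq_zero_of_T10_T01 {Z W : CTan N} (hZ : Z ∈ T10 N) (hW : W ∈ T01 N) :
    inner ℂ Z W = 0 := by
  obtain ⟨W, hW, rfl⟩ := hW
  simp [PiLp.inner_apply, conj_inl, conj_inr, mem_T10.1 hZ, mem_T10.1 hW]

theorem conj_mem_T01 {Z : CTan N} (hZ : Z ∈ T10 N) : conj Z ∈ T01 N :=
  Submodule.mem_map_of_mem hZ

/-- Conjugation is only semilinear, so ranks are compared along the ring automorphism of ℂ that
twists the scalars. -/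
theorem finrank_map_conj (S : Submodule ℂ (CTan N)) :
    Module.finrank ℂ (S.map (conj (N := N))) = Module.finrank ℂ S := by
  have hinj : Function.Injective (conj (N := N)) :=
    Function.LeftInverse.injective (g := conj) conj_conj
  have h := rank_eq_of_equiv_equiv (starRingEnd ℂ)
    (Submodule.equivMapOfInjective conj hinj S).toAddEquiv (starRingAut (R := ℂ)).bijective
    (fun r m => (Submodule.equivMapOfInjective conj hinj S).map_smulₛₗ r m)
  rw [Module.finrank, Module.finrank, h]

end CTan

/-! ### Complex linearity of the pairing -/

section Pairing

variable {N : ℕ}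

theorem pair1_apply (α : CSpace N →L[ℝ] ℂ) (Z : CTan N) :
    pair1 α Z = α (CTan.re Z) + Complex.I * α (CTan.im Z) := rfl

theorem pair1_smul (α : CSpace N →L[ℝ] ℂ) (c : ℂ) (Z : CTan N) :
    pair1 α (c • Z) = c * pair1 α Z := by
  simp only [pair1_apply, CTan.re_smul, CTan.im_smul, map_add, map_sub, map_smul,
    Complex.real_smul]
  nth_rw 5 [← Complex.re_add_im c]
  linear_combination (-(c.im : ℂ) * α (CTan.im Z)) * Complex.I_sq

@[simp]
theorem pair1_ofReal (α : CSpace N →L[ℝ] ℂ) (v : CSpace N) :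
    pair1 α (CTan.ofReal v) = α v := by
  simp [pair1_apply]

theorem component1_apply (S : Submodule ℂ (CTan N)) (α : CSpace N →L[ℝ] ℂ) (v : CSpace N) :
    component1 S α v = pair1 α (S.starProjection (CTan.ofReal v)) := rfl

end Pairing

/-! ### The orthogonal splitting of T(M) ⊗ ℂ, and ∂_b against ∂ -/

section Tangent

variable {N m : ℕ} {M : Type*} [TopologicalSpace M] [ChartedSpace (EuclideanSpace ℝ (Fin m)) M]
  {ι : M → CSpace N} {p : M}

theorem re_im_mem_tangentSub {Z : CTan N} (hZ : Z ∈ complexTangent m ι p) :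
    CTan.re Z ∈ tangentSub m ι p ∧ CTan.im Z ∈ tangentSub m ι p := by
  induction hZ using Submodule.span_induction with
  | mem x hx =>
    obtain ⟨v, hv, rfl⟩ := hx
    simpa using hv
  | zero => simp
  | add x y _ _ hx hy =>
    simp only [map_add]
    exact ⟨add_mem hx.1 hy.1, add_mem hx.2 hy.2⟩
  | smul c x _ hx =>
    rw [CTan.re_smul, CTan.im_smul]
    exact ⟨sub_mem (Submodule.smul_mem _ _ hx.1) (Submodule.smul_mem _ _ hx.2),
      add_mem (Submodule.smul_mem _ _ hx.2) (Submodule.smul_mem _ _ hx.1)⟩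

theorem ofReal_mem_complexTangent {v : CSpace N} (hv : v ∈ tangentSub m ι p) :
    CTan.ofReal v ∈ complexTangent m ι p :=
  Submodule.subset_span ⟨v, hv, rfl⟩

theorem conj_mem_complexTangent {Z : CTan N} (hZ : Z ∈ complexTangent m ι p) :
    CTan.conj Z ∈ complexTangent m ι p := by
  induction hZ using Submodule.span_induction with
  | mem x hx =>
    obtain ⟨v, hv, rfl⟩ := hx
    simpa using ofReal_mem_complexTangent hv
  | zero => simp
  | add x y _ _ hx hy => simpa using add_mem hx hy
  | smul c x _ hx =>
    rw [LinearMap.map_smulₛₗ]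
    exact Submodule.smul_mem _ _ hx

theorem T01M_le_complexTangent : T01M m ι p ≤ complexTangent m ι p := by
  rintro _ ⟨Z, hZ, rfl⟩
  exact conj_mem_complexTangent hZ.2

theorem T01M_le_T01 : T01M m ι p ≤ CTan.T01 N :=
  Submodule.map_mono inf_le_left

theorem conj_mem_T01M {Z : CTan N} (hZ : Z ∈ T10M m ι p) : CTan.conj Z ∈ T01M m ι p :=
  Submodule.mem_map_of_mem hZ

theorem isOrtho_T10_T01 : (CTan.T10 N).IsOrtho (CTan.T01 N) :=
  Submodule.isOrtho_iff_inner_eq.2 fun _ hZ _ hW => CTan.inner_eq_zero_of_T10_T01 hZ hW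

theorem isOrtho_T10M_T01M : (T10M m ι p).IsOrtho (T01M m ι p) :=
  isOrtho_T10_T01.mono inf_le_left T01M_le_T01

/-- A real basis of T_p(M) spans the complexification over ℂ. This upper bound is all the dimension
count needs. -/
theorem finrank_complexTangent_le :
    Module.finrank ℂ (complexTangent m ι p) ≤ Module.finrank ℝ (tangentSub m ι p) := by
  let b := Module.finBasis ℝ (tangentSub m ι p)
  have hle : complexTangent m ι p ≤
      Submodule.span ℂ (Set.range fun i => CTan.ofReal (b i : CSpace N)) := by
    refine Submodule.span_le.2 ?_
    rintro _ ⟨v, hv, rfl⟩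
    have hsum := congrArg (fun w : tangentSub m ι p => CTan.ofReal (w : CSpace N))
      (b.sum_repr ⟨v, hv⟩)
    simp only [Submodule.coe_sum, Submodule.coe_smul, map_sum, map_smul] at hsum
    rw [← hsum]
    refine Submodule.sum_mem _ fun i _ => ?_
    have h := Submodule.smul_mem _ ((b.repr ⟨v, hv⟩ i : ℝ) : ℂ)
      (Submodule.subset_span (R := ℂ) (Set.mem_range_self
        (f := fun i => CTan.ofReal (b i : CSpace N)) i))
    simpa using h
  calc Module.finrank ℂ (complexTangent m ι p)
      ≤ _ := Submodule.finrank_mono hle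
    _ ≤ Fintype.card (Fin (Module.finrank ℝ (tangentSub m ι p))) := finrank_range_le_card _
    _ = _ := Fintype.card_fin _

variable {U : Set M} {Ln : M → CTan N}

theorem IsTransversalField.inner_T01M_conj (h : IsTransversalField m ι U Ln) (hp : p ∈ U)
    {Z : CTan N} (hZ : Z ∈ T01M m ι p) : inner ℂ Z (CTan.conj (Ln p)) = 0 := by
  obtain ⟨Z, hZ, rfl⟩ := hZ
  rw [CTan.inner_conj_conj, h.orthogonal p hp Z hZ, map_zero]

theorem IsTransversalField.inner_T10M_sub (h : IsTransversalField m ι U Ln) (hp : p ∈ U)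
    {Z : CTan N} (hZ : Z ∈ T10M m ι p) : inner ℂ Z (Ln p - CTan.conj (Ln p)) = 0 := by
  rw [inner_sub_right, h.orthogonal p hp Z hZ,
    CTan.inner_eq_zero_of_T10_T01 hZ.1 (CTan.conj_mem_T01 (h.type10 p hp)), sub_zero]

theorem IsTransversalField.inner_T01M_sub (h : IsTransversalField m ι U Ln) (hp : p ∈ U)
    {Z : CTan N} (hZ : Z ∈ T01M m ι p) : inner ℂ Z (Ln p - CTan.conj (Ln p)) = 0 := by
  rw [inner_sub_right, h.inner_T01M_conj hp hZ,
    Submodule.isOrtho_iff_inner_eq.1 isOrtho_T10_T01.symm Z (T01M_le_T01 hZ) _ (h.type10 p hp),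
    sub_zero]

/-- If T were zero, L_n would have both types, hence be orthogonal to itself, against its unit
length. -/
theorem IsTransversalField.sub_conj_ne_zero (h : IsTransversalField m ι U Ln) (hp : p ∈ U) :
    Ln p - CTan.conj (Ln p) ≠ 0 := by
  intro h0
  have h1 : Ln p = CTan.conj (Ln p) := sub_eq_zero.1 h0
  have h2 : inner ℂ (Ln p) (Ln p) = 0 := by
    nth_rw 2 [h1]
    exact CTan.inner_eq_zero_of_T10_T01 (h.type10 p hp) (CTan.conj_mem_T01 (h.type10 p hp))
  have h3 := h.unit p hp
  rw [inner_self_eq_zero.1 h2, norm_zero] at h3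
  exact zero_ne_one h3

theorem IsTransversalField.finrank_sup (h : IsTransversalField m ι U Ln) (hp : p ∈ U) :
    Module.finrank ℂ ((T10M m ι p ⊔ T01M m ι p ⊔ ℂ ∙ (Ln p - CTan.conj (Ln p)) :
      Submodule ℂ (CTan N))) = 2 * Module.finrank ℂ (T10M m ι p) + 1 := by
  have h1 : (T10M m ι p ⊔ T01M m ι p).IsOrtho (ℂ ∙ (Ln p - CTan.conj (Ln p))) := by
    rw [Submodule.isOrtho_sup_left]
    constructor <;> refine Submodule.isOrtho_iff_inner_eq.2 fun Z hZ W hW => ?_ <;>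
      obtain ⟨c, rfl⟩ := Submodule.mem_span_singleton.1 hW <;> rw [inner_smul_right]
    · rw [h.inner_T10M_sub hp hZ, mul_zero]
    · rw [h.inner_T01M_sub hp hZ, mul_zero]
  have e1 := Submodule.finrank_sup_add_finrank_inf_eq (T10M m ι p ⊔ T01M m ι p)
    (ℂ ∙ (Ln p - CTan.conj (Ln p)))
  have e2 := Submodule.finrank_sup_add_finrank_inf_eq (T10M m ι p) (T01M m ι p)
  have e3 : Module.finrank ℂ (T01M m ι p) = Module.finrank ℂ (T10M m ι p) :=
    CTan.finrank_map_conj _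
  rw [h1.disjoint.eq_bot, finrank_bot, finrank_span_singleton (h.sub_conj_ne_zero hp)] at e1
  rw [isOrtho_T10M_T01M.disjoint.eq_bot, finrank_bot] at e2
  omega

theorem IsTransversalField.sup_le (h : IsTransversalField m ι U Ln) (hp : p ∈ U) :
    T10M m ι p ⊔ T01M m ι p ⊔ ℂ ∙ (Ln p - CTan.conj (Ln p)) ≤ complexTangent m ι p :=
  _root_.sup_le (_root_.sup_le inf_le_right T01M_le_complexTangent)
    ((Submodule.span_singleton_le_iff_mem _ _).2 (h.tangent p hp))

theorem finrank_tangentSub_le : Module.finrank ℝ (tangentSub m ι p) ≤ m :=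
  (LinearMap.finrank_range_le (embDeriv m ι p).toLinearMap).trans_eq finrank_euclideanSpace_fin

/-- The sum on the left has dimension 2 dim T^{1,0} + 1 ≥ m, while T_p(M) ⊗ ℂ has dimension at most
m. -/
theorem IsTransversalField.sup_eq (h : IsTransversalField m ι U Ln) (hp : p ∈ U)
    (hm : m ≤ 2 * Module.finrank ℂ (T10M m ι p) + 1) :
    T10M m ι p ⊔ T01M m ι p ⊔ ℂ ∙ (Ln p - CTan.conj (Ln p)) = complexTangent m ι p := by
  refine Submodule.eq_of_le_of_finrank_le (h.sup_le hp) ?_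
  rw [h.finrank_sup hp]
  exact finrank_complexTangent_le.trans (finrank_tangentSub_le.trans hm)

/-- The same count bounds the rank of the differential below by m, so it is injective by
rank-nullity. -/
theorem IsTransversalField.ker_embDeriv (h : IsTransversalField m ι U Ln) (hp : p ∈ U)
    (hm : m ≤ 2 * Module.finrank ℂ (T10M m ι p) + 1) :
    LinearMap.ker (embDeriv m ι p).toLinearMap = ⊥ := by
  have h1 := Submodule.finrank_mono (h.sup_le hp)
  rw [h.finrank_sup hp] at h1
  have h2 := finrank_complexTangent_le (m := m) (ι := ι) (p := p)
  have h3 := LinearMap.finrank_range_add_finrank_ker (embDeriv m ι p).toLinearMap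
  rw [finrank_euclideanSpace_fin] at h3
  change Module.finrank ℝ (tangentSub m ι p) + _ = _ at h3
  exact Submodule.finrank_eq_zero.1 (by omega)

theorem starProjection_eq_zero_of_inner {S : Submodule ℂ (CTan N)} {W : CTan N}
    (h : ∀ Z ∈ S, inner ℂ Z W = 0) : S.starProjection W = 0 :=
  (Submodule.starProjection_apply_eq_zero_iff S).2 ((Submodule.mem_orthogonal S W).2 h)

theorem starProjection_T10_add_T01M (Z W : CTan N) (hZ : Z ∈ CTan.T10 N) (hW : W ∈ CTan.T01 N) :
    (CTan.T10 N).starProjection (Z + W) = Z ∧ (CTan.T01 N).starProjection (Z + W) = W := by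
  have h := Submodule.isOrtho_iff_inner_eq.1 (isOrtho_T10_T01 (N := N))
  have h' := Submodule.isOrtho_iff_inner_eq.1 (isOrtho_T10_T01 (N := N)).symm
  rw [map_add, map_add, Submodule.starProjection_eq_self_iff.2 hZ,
    Submodule.starProjection_eq_self_iff.2 hW,
    starProjection_eq_zero_of_inner fun V hV => h V hV W hW,
    starProjection_eq_zero_of_inner fun V hV => h' V hV Z hZ, add_zero, zero_add]
  exact ⟨rfl, rfl⟩

variable {γ : M → CSpace N →L[ℝ] ℂ}

/-- On complexified tangent vectors of `M`, the types in `ℂ^N` differ from the types in `M` by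
multiples of `L_n` and `conj L_n`. -/
theorem IsTransversalField.starProjection_eq (h : IsTransversalField m ι U Ln) (hp : p ∈ U)
    (hm : m ≤ 2 * Module.finrank ℂ (T10M m ι p) + 1) (hγ : IsCharacteristicForm m ι U γ)
    (hγT : pair1 (γ p) (Ln p - CTan.conj (Ln p)) = -1) {Z : CTan N}
    (hZ : Z ∈ complexTangent m ι p) :
    (CTan.T10 N).starProjection Z = (T10M m ι p).starProjection Z - pair1 (γ p) Z • Ln p ∧
    (CTan.T01 N).starProjection Z =
      (T01M m ι p).starProjection Z + pair1 (γ p) Z • CTan.conj (Ln p) := by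
  rw [← h.sup_eq hp hm] at hZ
  obtain ⟨V, hV, W, hW, rfl⟩ := Submodule.mem_sup.1 hZ
  obtain ⟨X, hX, Y, hY, rfl⟩ := Submodule.mem_sup.1 hV
  obtain ⟨c, rfl⟩ := Submodule.mem_span_singleton.1 hW
  have hγV := hγ.annihilates p hp _ hV
  have hL := h.type10 p hp
  have hL' := CTan.conj_mem_T01 hL
  -- The left grouping is adapted to the types on M, where T is orthogonal to both; the right one to
  -- the types in ℂ^N, where T contributes to both.
  have hsplit : X + Y + c • (Ln p - CTan.conj (Ln p)) =
      (X + c • Ln p) + (Y + (-c) • CTan.conj (Ln p)) := by module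
  have hpair : pair1 (γ p) (X + Y + c • (Ln p - CTan.conj (Ln p))) = -c := by
    rw [map_add, hγV, pair1_smul, hγT]
    ring
  have hamb := starProjection_T10_add_T01M (X + c • Ln p) (Y + (-c) • CTan.conj (Ln p))
    (add_mem hX.1 (Submodule.smul_mem _ _ hL))
    (add_mem (T01M_le_T01 hY) (Submodule.smul_mem _ _ hL'))
  have ho := Submodule.isOrtho_iff_inner_eq.1 (isOrtho_T10M_T01M (m := m) (ι := ι) (p := p))
  have ho' := Submodule.isOrtho_iff_inner_eq.1
    (isOrtho_T10M_T01M (m := m) (ι := ι) (p := p)).symm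
  rw [hpair, hsplit, hamb.1, hamb.2, ← hsplit]
  simp only [map_add, map_smul]
  rw [Submodule.starProjection_eq_self_iff.2 hX, Submodule.starProjection_eq_self_iff.2 hY,
    starProjection_eq_zero_of_inner fun V hV => ho V hV Y hY,
    starProjection_eq_zero_of_inner fun V hV => ho' V hV X hX,
    starProjection_eq_zero_of_inner fun V hV => h.inner_T10M_sub hp hV,
    starProjection_eq_zero_of_inner fun V hV => h.inner_T01M_sub hp hV]
  constructor <;> module

/-- On tangent vectors of `M`, `∂_b λ = ∂λ + (L_n λ) γ` and `∂̄_b λ = ∂̄λ - (conj L_n λ) γ`. -/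
theorem IsTransversalField.delb_dbarb_eq (h : IsTransversalField m ι U Ln) (hp : p ∈ U)
    (hm : m ≤ 2 * Module.finrank ℂ (T10M m ι p) + 1) (hγ : IsCharacteristicForm m ι U γ)
    (hγT : pair1 (γ p) (Ln p - CTan.conj (Ln p)) = -1) (lam : CSpace N → ℂ) {v : CSpace N}
    (hv : v ∈ tangentSub m ι p) :
    delb m ι lam p v =
      del lam (ι p) v + pair1 (fderiv ℝ lam (ι p)) (Ln p) * γ p v ∧
    dbarb m ι lam p v =
      dbar lam (ι p) v - pair1 (fderiv ℝ lam (ι p)) (CTan.conj (Ln p)) * γ p v := by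
  obtain ⟨h1, h2⟩ := h.starProjection_eq hp hm hγ hγT (ofReal_mem_complexTangent hv)
  simp only [delb, dbarb, del, dbar, component1_apply, h1, h2, map_add, map_sub, pair1_smul,
    pair1_ofReal]
  constructor <;> ring

end Tangent

/-! ### Exterior derivatives of 1-forms on a normed space -/

section ExtDeriv

variable {V V' : Type*} [NormedAddCommGroup V] [NormedSpace ℝ V]
  [NormedAddCommGroup V'] [NormedSpace ℝ V']

theorem differentiableAt_ofSubsingleton {α : V → V →L[ℝ] ℂ} {x : V}
    (hα : DifferentiableAt ℝ α x) :
    DifferentiableAt ℝ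
      (fun y => ContinuousAlternatingMap.ofSubsingleton ℝ V ℂ (0 : Fin 1) (α y)) x :=
  (ContinuousAlternatingMap.ofSubsingletonLIE (𝕜 := ℝ) (E := V) (F := ℂ)
    (0 : Fin 1)).differentiableAt.comp x hα

theorem extDeriv1_apply {α : V → V →L[ℝ] ℂ} {x : V} (hα : DifferentiableAt ℝ α x) (v w : V) :
    extDeriv1 α x ![v, w] = fderiv ℝ α x v w - fderiv ℝ α x w v := by
  have h : ∀ a b : V, fderiv ℝ (fun y => α y b) x a = fderiv ℝ α x a b := fun a b => by
    rw [fderiv_clm_apply hα (differentiableAt_const b)]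
    simp
  rw [extDeriv1, extDeriv_apply (differentiableAt_ofSubsingleton hα), Fin.sum_univ_two, ← h, ← h,
    sub_eq_add_neg]
  simp only [Fin.val_zero, Fin.val_one, pow_zero, pow_one, one_smul, neg_smul]
  rfl

theorem extDeriv1_pullback {β : V' → V' →L[ℝ] ℂ} {f : V → V'} {x : V}
    (hβ : DifferentiableAt ℝ β (f x)) (hf : ContDiffAt ℝ ∞ f x) :
    extDeriv1 (fun u => (β (f u)).comp (fderiv ℝ f u)) x =
      (extDeriv1 β (f x)).compContinuousLinearMap (fderiv ℝ f x) := by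
  have h := extDeriv_pullback (differentiableAt_ofSubsingleton hβ) hf
    (by rw [minSmoothness_of_isRCLikeNormedField]; exact WithTop.coe_le_coe.2 le_top)
  exact h

/-- In d(gγ) = dg ∧ γ + g dγ the first term vanishes on vectors killed by γ at x, so no derivative
of g survives. -/
theorem extDeriv1_add_smul_apply {α γ : V → V →L[ℝ] ℂ} {g : V → ℂ} {x : V}
    (hα : DifferentiableAt ℝ α x) (hγ : DifferentiableAt ℝ γ x) (hg : DifferentiableAt ℝ g x)
    {v w : V} (hv : γ x v = 0) (hw : γ x w = 0) :
    extDeriv1 (fun u => α u + g u • γ u) x ![v, w] =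
      extDeriv1 α x ![v, w] + g x * extDeriv1 γ x ![v, w] := by
  have hgγ : DifferentiableAt ℝ (fun u => g u • γ u) x := hg.smul hγ
  have hs : DifferentiableAt ℝ (fun u => α u + g u • γ u) x := hα.add hgγ
  rw [extDeriv1_apply hs, extDeriv1_apply hα, extDeriv1_apply hγ,
    fderiv_fun_add hα hgγ, fderiv_fun_smul hg hγ]
  simp [hv, hw]
  ring

end ExtDeriv

/-! ### Differentiability in the preferred chart -/

section Regularity

variable {N : ℕ}

theorem DifferentiableAt.pair1 {V : Type*} [NormedAddCommGroup V] [NormedSpace ℝ V]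
    {A : V → CSpace N →L[ℝ] ℂ} {B : V → CTan N} {x : V} (hA : DifferentiableAt ℝ A x)
    (hB : DifferentiableAt ℝ B x) : DifferentiableAt ℝ (fun u => pair1 (A u) (B u)) x := by
  simp only [pair1_apply]
  exact (hA.clm_apply (CTan.re.differentiableAt.comp x hB)).add
    ((differentiableAt_const _).mul (hA.clm_apply (CTan.im.differentiableAt.comp x hB)))

/-- Conjugation only flips the sign of the imaginary part, so it need not be differentiated itself.
-/
theorem DifferentiableAt.pair1_conj {V : Type*} [NormedAddCommGroup V] [NormedSpace ℝ V]
    {A : V → CSpace N →L[ℝ] ℂ} {B : V → CTan N} {x : V} (hA : DifferentiableAt ℝ A x)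
    (hB : DifferentiableAt ℝ B x) :
    DifferentiableAt ℝ (fun u => _root_.pair1 (A u) (CTan.conj (B u))) x := by
  simp only [pair1_apply, CTan.re_conj, CTan.im_conj]
  exact (hA.clm_apply (CTan.re.differentiableAt.comp x hB)).add
    ((differentiableAt_const _).mul (hA.clm_apply (CTan.im.differentiableAt.comp x hB).neg))

theorem DifferentiableAt.component1 {V : Type*} [NormedAddCommGroup V] [NormedSpace ℝ V]
    {A : V → CSpace N →L[ℝ] ℂ} {x : V} (S : Submodule ℂ (CTan N))
    (hA : DifferentiableAt ℝ A x) : DifferentiableAt ℝ (fun u => component1 S (A u)) x := by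
  unfold _root_.component1 _root_.pair1
  exact ((hA.clm_comp (differentiableAt_const _)).add
    ((hA.clm_comp (differentiableAt_const _)).const_smul Complex.I)).clm_comp
    (differentiableAt_const _)

variable {m : ℕ} {M : Type*} [TopologicalSpace M] [ChartedSpace (EuclideanSpace ℝ (Fin m)) M]
  {ι : M → CSpace N} {p : M}

theorem fderiv_chart_eq_embDeriv (hι : MDifferentiableAt (𝓡 m) 𝓘(ℝ, CSpace N) ι p) :
    fderiv ℝ (ι ∘ (extChartAt (𝓡 m) p).symm) (extChartAt (𝓡 m) p p) = embDeriv m ι p := by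
  have h : mfderiv (𝓡 m) 𝓘(ℝ, CSpace N) ι p = _ := hι.mfderiv
  rw [embDeriv, h]
  simp [fderivWithin_univ, writtenInExtChartAt, Function.comp_def]
  rfl

variable [IsManifold (𝓡 m) ∞ M]

/-- By the chain rule. It is needed at every u near the centre, since identities between forms hold
only on tangent vectors and must be differentiated. -/
theorem fderiv_chart_mem_tangentSub (hι : ContMDiff (𝓡 m) 𝓘(ℝ, CSpace N) ∞ ι)
    {u : EuclideanSpace ℝ (Fin m)} (hu : u ∈ (extChartAt (𝓡 m) p).target)
    (v : EuclideanSpace ℝ (Fin m)) :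
    fderiv ℝ (ι ∘ (extChartAt (𝓡 m) p).symm) u v ∈
      tangentSub m ι ((extChartAt (𝓡 m) p).symm u) := by
  have h1 : MDifferentiableAt 𝓘(ℝ, EuclideanSpace ℝ (Fin m)) (𝓡 m)
      (extChartAt (𝓡 m) p).symm u :=
    ((contMDiffOn_extChartAt_symm (n := ∞) p).contMDiffAt
      ((isOpen_extChartAt_target p).mem_nhds hu)).mdifferentiableAt (by simp)
  have h2 := mfderiv_comp u ((hι _).mdifferentiableAt (by simp)) h1
  rw [mfderiv_eq_fderiv] at h2
  rw [h2]
  exact ⟨_, rfl⟩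

theorem contDiffAt_comp_chart_symm {F : Type*} [NormedAddCommGroup F] [NormedSpace ℝ F]
    {f : M → F} (hf : ContMDiffAt (𝓡 m) 𝓘(ℝ, F) ∞ f p) :
    ContDiffAt ℝ ∞ (f ∘ (extChartAt (𝓡 m) p).symm) (extChartAt (𝓡 m) p p) := by
  have h1 := (contMDiffOn_extChartAt_symm (I := 𝓡 m) (n := ∞) p).contMDiffAt
      (extChartAt_target_mem_nhds p)
  have h2 : ContMDiffAt (𝓡 m) 𝓘(ℝ, F) ∞ f
      ((extChartAt (𝓡 m) p).symm (extChartAt (𝓡 m) p p)) := by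
    rwa [extChartAt_to_inv]
  exact (h2.comp _ h1).contDiffAt

end Regularity

/-! ### The exterior derivative on M -/

section Main

variable {N m : ℕ} {M : Type*} [TopologicalSpace M] [ChartedSpace (EuclideanSpace ℝ (Fin m)) M]
  {ι : M → CSpace N} {p : M}

theorem extDerivM_embDeriv (hker : LinearMap.ker (embDeriv m ι p).toLinearMap = ⊥)
    (α : M → CSpace N →L[ℝ] ℂ) (v w : EuclideanSpace ℝ (Fin m)) :
    extDerivM m ι α p ![embDeriv m ι p v, embDeriv m ι p w] =
      extDeriv1 (chartForm m ι α p) (extChartAt (𝓡 m) p p) ![v, w] := by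
  have h := fun z => LinearMap.leftInverse_apply_of_inj hker z
  rw [extDerivM, ContinuousAlternatingMap.compContinuousLinearMap_apply]
  congr 1
  funext i
  fin_cases i
  · exact h v
  · exact h w

variable {U : Set M} {γ : M → CSpace N →L[ℝ] ℂ}

/-- L and its conjugate already have pure types, so the mixed projections vanish and only one
summand remains. -/
theorem component11_conj {S S' : Submodule ℂ (CTan N)} (h : S.IsOrtho S')
    (η : CSpace N [⋀^Fin 2]→L[ℝ] ℂ) {L : CTan N} (hL : L ∈ S) (hL' : CTan.conj L ∈ S') :
    component11 S S' η L (CTan.conj L) = pair2 η L (CTan.conj L) := by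
  have ho := Submodule.isOrtho_iff_inner_eq.1 h
  have ho' := Submodule.isOrtho_iff_inner_eq.1 h.symm
  rw [component11, Submodule.starProjection_eq_self_iff.2 hL,
    Submodule.starProjection_eq_self_iff.2 hL',
    starProjection_eq_zero_of_inner fun V hV => ho V hV _ hL',
    starProjection_eq_zero_of_inner fun V hV => ho' V hV _ hL]
  have h0 : pair2 η 0 0 = 0 := by
    have : ∀ y : CSpace N, η ![0, y] = 0 := fun y => η.map_coord_zero 0 rfl
    simp [pair2, this]
  rw [h0, add_zero]

/-- For L = X + iY, γ kills both L and its conjugate, so γ(X) + iγ(Y) = γ(X) - iγ(Y) = 0. -/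
theorem IsCharacteristicForm.re_im_eq_zero (hγ : IsCharacteristicForm m ι U γ)
    (hp : p ∈ U) {L : CTan N} (hL : L ∈ T10M m ι p) :
    γ p (CTan.re L) = 0 ∧ γ p (CTan.im L) = 0 := by
  have h1 := hγ.annihilates p hp L (Submodule.mem_sup_left hL)
  have h2 := hγ.annihilates p hp _ (Submodule.mem_sup_right (conj_mem_T01M hL))
  rw [pair1_apply] at h1 h2
  rw [CTan.re_conj, CTan.im_conj, map_neg] at h2
  have h3 : γ p (CTan.re L) = 0 := by linear_combination (h1 + h2) / 2
  rw [h3, zero_add] at h1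
  exact ⟨h3, (mul_eq_zero.1 h1).resolve_left Complex.I_ne_zero⟩

variable [IsManifold (𝓡 m) ∞ M]

/-- The exterior derivative on `M` of a form that agrees on `M` with `β + g γ`, evaluated on
tangent vectors annihilated by `γ`. -/
theorem extDerivM_eq_of_forall_eq (hι : ContMDiff (𝓡 m) 𝓘(ℝ, CSpace N) ∞ ι)
    (hker : LinearMap.ker (embDeriv m ι p).toLinearMap = ⊥) (hU : IsOpen U) (hp : p ∈ U)
    (hγ : ContMDiffAt (𝓡 m) 𝓘(ℝ, CSpace N →L[ℝ] ℂ) ∞ γ p)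
    {α : M → CSpace N →L[ℝ] ℂ} {β : CSpace N → CSpace N →L[ℝ] ℂ} {g : M → ℂ}
    (hβ : DifferentiableAt ℝ β (ι p))
    (hg : DifferentiableAt ℝ (g ∘ (extChartAt (𝓡 m) p).symm) (extChartAt (𝓡 m) p p))
    (hα : ∀ q ∈ U, ∀ v ∈ tangentSub m ι q, α q v = β (ι q) v + g q * γ q v)
    {x y : CSpace N} (hx : x ∈ tangentSub m ι p) (hy : y ∈ tangentSub m ι p)
    (hγx : γ p x = 0) (hγy : γ p y = 0) :
    extDerivM m ι α p ![x, y] =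
      extDeriv1 β (ι p) ![x, y] + g p * extDerivM m ι γ p ![x, y] := by
  obtain ⟨v, rfl⟩ := hx
  obtain ⟨w, rfl⟩ := hy
  have hφ := contDiffAt_comp_chart_symm (hι p)
  have hφ0 : (ι ∘ (extChartAt (𝓡 m) p).symm) (extChartAt (𝓡 m) p p) = ι p := by
    rw [Function.comp_apply, extChartAt_to_inv]
  have hA := fderiv_chart_eq_embDeriv ((hι p).mdifferentiableAt (by simp))
  have hsymm : ContinuousAt (extChartAt (𝓡 m) p).symm (extChartAt (𝓡 m) p p) :=
    continuousAt_extChartAt_symm p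
  have hUmem : U ∈ 𝓝 ((extChartAt (𝓡 m) p).symm (extChartAt (𝓡 m) p p)) := by
    rw [extChartAt_to_inv]
    exact hU.mem_nhds hp
  have hdφ : DifferentiableAt ℝ (fderiv ℝ (ι ∘ (extChartAt (𝓡 m) p).symm))
      (extChartAt (𝓡 m) p p) :=
    (hφ.fderiv_right (m := 1) (WithTop.coe_le_coe.2 le_top)).differentiableAt one_ne_zero
  have hβ' : DifferentiableAt ℝ β
      ((ι ∘ (extChartAt (𝓡 m) p).symm) (extChartAt (𝓡 m) p p)) := by
    rwa [hφ0]
  have hpull : DifferentiableAt ℝ (fun u => (β ((ι ∘ (extChartAt (𝓡 m) p).symm) u)).comp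
      (fderiv ℝ (ι ∘ (extChartAt (𝓡 m) p).symm) u)) (extChartAt (𝓡 m) p p) :=
    (hβ'.comp _ (hφ.differentiableAt (by simp))).clm_comp hdφ
  have hγchart : DifferentiableAt ℝ (chartForm m ι γ p) (extChartAt (𝓡 m) p p) :=
    ((contDiffAt_comp_chart_symm hγ).differentiableAt (by simp)).clm_comp hdφ
  -- The hypothesis on U gives equality of the coordinate forms on a neighbourhood, so their
  -- exterior derivatives at the centre agree.
  have hev : chartForm m ι α p =ᶠ[𝓝 (extChartAt (𝓡 m) p p)] fun u =>
      (β ((ι ∘ (extChartAt (𝓡 m) p).symm) u)).comp (fderiv ℝ (ι ∘ (extChartAt (𝓡 m) p).symm) u)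
        + (g ∘ (extChartAt (𝓡 m) p).symm) u • chartForm m ι γ p u := by
    filter_upwards [extChartAt_target_mem_nhds (I := 𝓡 m) p, hsymm hUmem] with u hu huU
    ext z
    exact hα _ huU _ (fderiv_chart_mem_tangentSub hι hu z)
  have hγ0 : ∀ z, γ p (embDeriv m ι p z) = 0 →
      chartForm m ι γ p (extChartAt (𝓡 m) p p) z = 0 := fun z hz => by
    rw [chartForm, hA, extChartAt_to_inv]
    exact hz
  have hd : extDeriv1 (chartForm m ι α p) (extChartAt (𝓡 m) p p) = _ :=
    Filter.EventuallyEq.extDeriv_eq (hev.fun_comp _)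
  change extDerivM m ι α p ![embDeriv m ι p v, embDeriv m ι p w] =
    extDeriv1 β (ι p) ![embDeriv m ι p v, embDeriv m ι p w] +
      g p * extDerivM m ι γ p ![embDeriv m ι p v, embDeriv m ι p w]
  rw [extDerivM_embDeriv hker, extDerivM_embDeriv hker, hd]
  refine (extDeriv1_add_smul_apply hpull hγchart hg (hγ0 v hγx) (hγ0 w hγy)).trans ?_
  rw [extDeriv1_pullback hβ' hφ, hφ0, hA, Function.comp_apply, extChartAt_to_inv,
    ContinuousAlternatingMap.compContinuousLinearMap_apply]
  congr 2
  funext i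
  fin_cases i <;> rfl

end Main

/-! ### The proposition -/

theorem mainTheorem4 {n N : ℕ} (hn : 1 ≤ n) (hnN : n ≤ N)
    {M : Type*} [TopologicalSpace M] [CompactSpace M]
    [ChartedSpace (EuclideanSpace ℝ (Fin (2 * n - 1))) M] [IsManifold (𝓡 (2 * n - 1)) ∞ M]
    (ι : M → CSpace N)
    (hι : Manifold.IsSmoothEmbedding (𝓡 (2 * n - 1)) 𝓘(ℝ, CSpace N) ∞ ι)
    (hCR : IsCROfRank (2 * n - 1) ι n) (hpsc : IsWeaklyPseudoconvex (2 * n - 1) ι)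
    (U : Set M) (hU : IsOpen U)
    (Ln : M → CTan N) (hLn : IsTransversalField (2 * n - 1) ι U Ln)
    (γ : M → CSpace N →L[ℝ] ℂ) (hγ : IsCharacteristicForm (2 * n - 1) ι U γ)
    (hγT : ∀ p ∈ U, pair1 (γ p) (Ln p - CTan.conj (Ln p)) = -1)
    (W : Set (CSpace N)) (hW : IsOpen W) (hMW : Set.range ι ⊆ W)
    (lam : CSpace N → ℂ) (hlam : ContDiffOn ℝ ∞ lam W)
    (p : M) (hp : p ∈ U) (L : CTan N) (hL : L ∈ T10M (2 * n - 1) ι p) :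
    1 / 2 * (del01 (dbar lam) (ι p) L (CTan.conj L) - dbar10 (del lam) (ι p) L (CTan.conj L))
      - 1 / 2 * (delb01 (2 * n - 1) ι (dbarb (2 * n - 1) ι lam) p L (CTan.conj L)
          - dbarb10 (2 * n - 1) ι (delb (2 * n - 1) ι lam) p L (CTan.conj L))
      = 1 / 2 * pair1 (fderiv ℝ lam (ι p)) (Ln p + CTan.conj (Ln p))
          * leviForm (2 * n - 1) ι γ p L L := by
  have hιs := hι.contMDiff
  have hrank : ∀ q : M, 2 * n - 1 ≤ 2 * Module.finrank ℂ (T10M (2 * n - 1) ι q) + 1 := fun q => by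
    rw [hCR q]
    omega
  have hker := hLn.ker_embDeriv hp (hrank p)
  have hγp : ContMDiffAt (𝓡 (2 * n - 1)) 𝓘(ℝ, CSpace N →L[ℝ] ℂ) ∞ γ p :=
    hγ.smooth.contMDiffAt (hU.mem_nhds hp)
  have hLp : ContMDiffAt (𝓡 (2 * n - 1)) 𝓘(ℝ, CTan N) ∞ Ln p :=
    hLn.smooth.contMDiffAt (hU.mem_nhds hp)
  have hdlam : DifferentiableAt ℝ (fderiv ℝ lam) (ι p) :=
    ((hlam.contDiffAt (hW.mem_nhds (hMW ⟨p, rfl⟩))).fderiv_right (m := 1)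
      (WithTop.coe_le_coe.2 le_top)).differentiableAt one_ne_zero
  have hA : DifferentiableAt ℝ (fun u => fderiv ℝ lam
      ((ι ∘ (extChartAt (𝓡 (2 * n - 1)) p).symm) u)) (extChartAt (𝓡 (2 * n - 1)) p p) := by
    refine DifferentiableAt.comp _ ?_
      ((contDiffAt_comp_chart_symm (hιs p)).differentiableAt (by simp))
    rwa [Function.comp_apply, extChartAt_to_inv]
  have hB := (contDiffAt_comp_chart_symm hLp).differentiableAt (by simp)
  have hform := fun q (hq : q ∈ U) v hv =>
    hLn.delb_dbarb_eq hq (hrank q) hγ (hγT q hq) lam (v := v) hv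
  -- The two formulas for ∂_b λ and ∂̄_b λ after applying d, on real tangent vectors killed by γ.
  have key : ∀ x ∈ tangentSub (2 * n - 1) ι p, ∀ y ∈ tangentSub (2 * n - 1) ι p,
      γ p x = 0 → γ p y = 0 →
      extDerivM (2 * n - 1) ι (delb (2 * n - 1) ι lam) p ![x, y] =
        extDeriv1 (del lam) (ι p) ![x, y] + pair1 (fderiv ℝ lam (ι p)) (Ln p) *
          extDerivM (2 * n - 1) ι γ p ![x, y] ∧
      extDerivM (2 * n - 1) ι (dbarb (2 * n - 1) ι lam) p ![x, y] =
        extDeriv1 (dbar lam) (ι p) ![x, y] + -pair1 (fderiv ℝ lam (ι p)) (CTan.conj (Ln p)) *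
          extDerivM (2 * n - 1) ι γ p ![x, y] := fun x hx y hy h1 h2 =>
    ⟨extDerivM_eq_of_forall_eq (g := fun q => pair1 (fderiv ℝ lam (ι q)) (Ln q))
      hιs hker hU hp hγp (hdlam.component1 _) (hA.pair1 hB)
      (fun q hq v hv => (hform q hq v hv).1) hx hy h1 h2,
    extDerivM_eq_of_forall_eq (β := dbar lam)
      (g := fun q => -pair1 (fderiv ℝ lam (ι q)) (CTan.conj (Ln q)))
      hιs hker hU hp hγp (hdlam.component1 _) (hA.pair1_conj hB).neg
      (fun q hq v hv => by rw [(hform q hq v hv).2, sub_eq_add_neg, neg_mul]) hx hy h1 h2⟩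
  obtain ⟨hX, hY⟩ := re_im_mem_tangentSub hL.2
  obtain ⟨hγX, hγY⟩ := hγ.re_im_eq_zero hp hL
  have hY' := neg_mem hY
  have hγY' : γ p (-CTan.im L) = 0 := by rw [map_neg, hγY, neg_zero]
  rw [del01, dbar10, delb01, dbarb10,
    component11_conj isOrtho_T10_T01 _ hL.1 (CTan.conj_mem_T01 hL.1),
    component11_conj isOrtho_T10_T01 _ hL.1 (CTan.conj_mem_T01 hL.1),
    component11_conj isOrtho_T10M_T01M _ hL (conj_mem_T01M hL),
    component11_conj isOrtho_T10M_T01M _ hL (conj_mem_T01M hL), leviForm]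
  simp only [pair2, CTan.re_conj, CTan.im_conj]
  -- With L = X + iY, the bilinear expansion on L ∧ conj L uses exactly the pairs (X, X), (Y, -Y),
  -- (X, -Y) and (Y, X).
  obtain ⟨a1, b1⟩ := key _ hX _ hX hγX hγX
  obtain ⟨a2, b2⟩ := key _ hY _ hY' hγY hγY'
  obtain ⟨a3, b3⟩ := key _ hX _ hY' hγX hγY'
  obtain ⟨a4, b4⟩ := key _ hY _ hX hγY hγX
  rw [a1, a2, a3, a4, b1, b2, b3, b4, map_add]
  ring
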